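/- **Lemma 3.4.** Let $p\ge 2$, $d\ge 1$, $n\ge 2$ be integers, $G$ a simple graph on $\{1,\dots,n\}$ with edge set $E$, and $\bm p:\{1,\dots,n\}\to\mathbb{R}^d$ a generic configuration, i.e. its $nd$ coordinates are algebraically independent over $\mathbb{Q}$. *Stresses.* Put $\varepsilon_{ij}=1$ if $i<j$ and $\varepsilon_{ij}=-1$ if $i>j$ (so $\varepsilon_{ij}^p=1$ when $p$ is even). A *self-stress* of $(G,\bm p)$ is a map $\omega:E\to\mathbb{R}$ with $\sum_{j:ij\in E}\omega(ij)\,\varepsilon_{ij}^{\,p}\,(\bm p(j)_k-\bm p(i)_k)^{p-1}=0$ for all vertices $i$ and all $k\in\{1,\dots,d\}$. A *$k$-th coordinated self-stress* is a map $\omega^k:E\to\mathbb{R}$ of the form $\omega^k(ij)=\omega(ij)\,(\bm p(j)_k-\bm p(i)_k)^{p-2}$ ($ij\in E$, $i<j$) for some self-stress $\omega$. For $w:E\to\mathbb{R}$, the Laplacian $L_{G,w}$ is the $n\times n$ matrix with diagonal entries $\sum_{k:ik\in E}w(ik)$, off-diagonal entries $-w(ij)$ if $ij\in E$, and $0$ otherwise.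 *Varieties.* Let $f_p:\mathbb{C}^n\to\mathbb{C}^{\binom n2}$, $f_p(x)_{ij}=(x_i-x_j)^p$ for $i<j$, let $\mathcal{CM}_n^p$ be the Zariski closure of its image, and let $\pi_G:\mathbb{C}^{\binom n2}\to\mathbb{C}^{E}$ be the coordinate projection. For an affine cone $\mathcal{V}\subseteq\mathbb{C}^m$ with Zariski tangent spaces $T_y\mathcal{V}$, points $x_1,\dots,x_d\in\mathcal{V}$ are *generic* if every polynomial with rational coefficients vanishing at $(x_1,\dots,x_d)$ vanishes on $\mathcal{V}^d$. The *$d$-tangent contact locus* at $x_1,\dots,x_d$ is the Zariski closure of $\{y\in\mathcal{V}: T_y\mathcal{V}\subseteq\langle T_{x_1}\mathcal{V},\dots,T_{x_d}\mathcal{V}\rangle\}$. $\mathcal{V}$ is *$d$-tangentially weakly defective* if, for some generic $x_1,\dots,x_d\in\mathcal{V}$ and some $i$, an irreducible component of the $d$-tangent contact locus at $x_1,\dots,x_d$ that contains $x_i$ has dimension at least two. *Claim.* If for every $k\in\{1,\dots,d\}$ the framework $(G,\bm p)$ has a $k$-th coordinated self-stress $\omega^k$ with $\operatorname{rank}L_{G,\omega^k}=n-2$,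 then $\overline{\pi_G(\mathcal{CM}_n^p)}$ (Zariski closure) is not $d$-tangentially weakly defective. -/

import Mathlib

noncomputable section

namespace LpRigidity

/-! ### Affine algebraic sets in complex affine space -/

section Varieties

variable {σ : Type*}

/-- The Zariski closure of a set of points of `ℂ^σ`. -/
def zariskiClosure (S : Set (σ → ℂ)) : Set (σ → ℂ) :=
  MvPolynomial.zeroLocus ℂ (MvPolynomial.vanishingIdeal ℂ S)

/-- Zariski closed sets, i.e. the algebraic sets. -/
def IsZariskiClosed (S : Set (σ → ℂ)) : Prop :=
  zariskiClosure S = S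

/-- A nonempty algebraic set that is not the union of two proper algebraic subsets. -/
def IsIrreducibleVariety (Z : Set (σ → ℂ)) : Prop :=
  IsZariskiClosed Z ∧ Z.Nonempty ∧
    ∀ A B : Set (σ → ℂ), IsZariskiClosed A → IsZariskiClosed B → Z = A ∪ B → Z = A ∨ Z = B

/-- `Z` is an irreducible component of `C`: a maximal irreducible algebraic subset. -/
def IsComponent (C Z : Set (σ → ℂ)) : Prop :=
  Maximal (fun W => IsIrreducibleVariety W ∧ W ⊆ C) Z

/-- The dimension of an algebraic set: the Krull dimension of its coordinate ring
(`⊥` for the empty set). -/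
def varietyDim (Z : Set (σ → ℂ)) : WithBot ℕ∞ :=
  ringKrullDim (MvPolynomial σ ℂ ⧸ MvPolynomial.vanishingIdeal ℂ Z)

/-- The (Zariski) tangent space `T_y V`, as a linear subspace of `ℂ^σ`: the common kernel of the
differentials at `y` of all polynomials vanishing on `V`. -/
def tangentSpace [Fintype σ] (V : Set (σ → ℂ)) (y : σ → ℂ) : Submodule ℂ (σ → ℂ) where
  carrier := {v | ∀ f ∈ MvPolynomial.vanishingIdeal ℂ V,
    ∑ s, MvPolynomial.eval y (MvPolynomial.pderiv s f) * v s = 0}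
  zero_mem' := by
    intro f _
    simp
  add_mem' := by
    intro v w hv hw f hf
    simp [mul_add, Finset.sum_add_distrib, hv f hf, hw f hf]
  smul_mem' := by
    intro c v hv f hf
    have h := hv f hf
    have e : ∀ s, MvPolynomial.eval y (MvPolynomial.pderiv s f) * (c • v) s
        = c * (MvPolynomial.eval y (MvPolynomial.pderiv s f) * v s) := by
      intro s
      simp only [Pi.smul_apply, smul_eq_mul]
      ring
    simp only [e, ← Finset.mul_sum, h, mul_zero]

/-- `x₁, …, x_d` are generic points of `V`: the point `(x₁, …, x_d)` of `V × ⋯ × V` is generic,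
that is, each polynomial with rational coefficients vanishing at it vanishes on `V × ⋯ × V`. -/
def IsGenericTuple {d : ℕ} (V : Set (σ → ℂ)) (x : Fin d → σ → ℂ) : Prop :=
  (∀ i, x i ∈ V) ∧
    ∀ f : MvPolynomial (Fin d × σ) ℚ, MvPolynomial.aeval (fun a => x a.1 a.2) f = 0 →
      ∀ y : Fin d → σ → ℂ, (∀ i, y i ∈ V) → MvPolynomial.aeval (fun a => y a.1 a.2) f = 0

/-- The `d`-tangent contact locus of `V` at `x₁, …, x_d`. -/
def tangentContactLocus [Fintype σ] {d : ℕ} (V : Set (σ → ℂ)) (x : Fin d → σ → ℂ) : Set (σ → ℂ) :=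
  zariskiClosure {y | y ∈ V ∧ tangentSpace V y ≤ ⨆ i, tangentSpace V (x i)}

/-- `V` (the affine cone of a projective variety) is `d`-tangentially weakly defective. Its
negation says that at *every* choice of generic points `x₁, …, x_d` of `V`, for every `i`, every
irreducible component through `x_i` of the tangent contact locus has dimension at most one. -/
def IsTangentiallyWeaklyDefective [Fintype σ] (d : ℕ) (V : Set (σ → ℂ)) : Prop :=
  ∃ x : Fin d → σ → ℂ, IsGenericTuple V x ∧
    ∃ (i : Fin d) (Z : Set (σ → ℂ)),
      IsComponent (tangentContactLocus V x) Z ∧ x i ∈ Z ∧ 2 ≤ varietyDim Z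

end Varieties

/-! ### Cayley–Menger varieties

The coordinates of `ℂ^(n choose 2)` are indexed by the edges of the complete graph on `Fin n`. -/

/-- `(f_p(x))_{ij} = (x_i - x_j)^p` for `i < j`. -/
def measurementMap (n p : ℕ) (x : Fin n → ℂ) : (⊤ : SimpleGraph (Fin n)).edgeSet → ℂ :=
  fun e => (x (e : Sym2 (Fin n)).inf - x (e : Sym2 (Fin n)).sup) ^ p

/-- The `p`-Cayley–Menger variety `CM_n^p`. -/
def cayleyMenger (n p : ℕ) : Set ((⊤ : SimpleGraph (Fin n)).edgeSet → ℂ) :=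
  zariskiClosure (Set.range (measurementMap n p))

/-- The coordinate projection `π_G : ℂ^(n choose 2) → ℂ^E(G)`. -/
def graphProj {n : ℕ} (G : SimpleGraph (Fin n))
    (z : (⊤ : SimpleGraph (Fin n)).edgeSet → ℂ) : G.edgeSet → ℂ :=
  fun e => z ⟨e, SimpleGraph.edgeSet_mono le_top e.2⟩

/-- The Zariski closure of `π_G(CM_n^p)`. -/
def projectedCayleyMenger {n : ℕ} (G : SimpleGraph (Fin n)) (p : ℕ) : Set (G.edgeSet → ℂ) :=
  zariskiClosure (graphProj G '' cayleyMenger n p)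

/-! ### Frameworks, self-stresses and weighted Laplacians -/

/-- A point configuration is generic if its `n * d` coordinates are algebraically independent
over `ℚ`. -/
def IsGenericConfig {n d : ℕ} (P : Fin n → Fin d → ℝ) : Prop :=
  AlgebraicIndependent ℚ (fun a : Fin n × Fin d => P a.1 a.2)

open scoped Classical in
/-- The value `w(ij)` of an edge weight, set to `0` if `ij` is not an edge. -/
def edgeVal {n : ℕ} {G : SimpleGraph (Fin n)} (w : G.edgeSet → ℝ) (i j : Fin n) : ℝ :=
  if h : G.Adj i j then w ⟨s(i, j), h⟩ else 0

/-- The Laplacian matrix `L_{G,w}` of a graph `G` with edge weight `w`. -/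
def weightedLaplacian {n : ℕ} {G : SimpleGraph (Fin n)} (w : G.edgeSet → ℝ) :
    Matrix (Fin n) (Fin n) ℝ :=
  Matrix.of fun i j => if i = j then ∑ k, edgeVal w i k else -edgeVal w i j

/-- The sign `ε_{ij}^p`, where `ε_{ij} = 1` if `i < j` and `ε_{ij} = -1` otherwise.
It is `1` for even `p`; for odd `p` it records that `f_p` orients each edge
from its smaller to its larger end. -/
def orientSign {n : ℕ} (p : ℕ) (i j : Fin n) : ℝ :=
  if i < j then 1 else (-1) ^ p

/-- `w` is a self-stress of `(G, P)` in `ℓ_p`: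
`∑_{j : ij ∈ E(G)} w(ij) (P(j) - P(i))^(p-1) = 0` for every vertex `i`, in every coordinate
(for odd `p`, with the signs that make this the left kernel of the Jacobian of the
measurement map). -/
def IsSelfStress {n d : ℕ} {G : SimpleGraph (Fin n)} (p : ℕ) (P : Fin n → Fin d → ℝ)
    (w : G.edgeSet → ℝ) : Prop :=
  ∀ (i : Fin n) (k : Fin d),
    ∑ j, edgeVal w i j * (orientSign p i j * (P j k - P i k) ^ (p - 1)) = 0

/-- `wk` is a `k`-th coordinated self-stress of `(G, P)`: there is a self-stress `w` with
`wk(ij) = w(ij) (P(j)_k - P(i)_k)^(p-2)` for the edges `ij`, `i < j`. -/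
def IsCoordinatedSelfStress {n d : ℕ} {G : SimpleGraph (Fin n)} (p : ℕ)
    (P : Fin n → Fin d → ℝ) (k : Fin d) (wk : G.edgeSet → ℝ) : Prop :=
  ∃ w : G.edgeSet → ℝ, IsSelfStress p P w ∧
    ∀ e : G.edgeSet, wk e =
      w e * (P (e : Sym2 (Fin n)).sup k - P (e : Sym2 (Fin n)).inf k) ^ (p - 2)

end LpRigidity

end

/-!
Write `V` for the projected Cayley–Menger variety, `W ⊆ ℂ^E` for the space of edge differences
`q_i - q_j` of configurations `q` on the line, and `φ` for the coordinatewise `p`-th power map of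
`ℂ^E`. As `φ` is finite, hence closed, `V = φ(W)` (`mem_projectedCayleyMenger`).

*Tangent spaces.* Always `z^(p-1) W ⊆ T_{φ(z)} V` for `z ∈ W`, and equality holds when `φ(z)` is
generic: a tangent vector at a generic point `x` defines a derivation of `ℚ[x]`, which extends to
`ℂ` and is then applied to `z` (`exists_eq_pow_mul_edgeDiff_of_mem_tangentSpace`).

*From the real framework to the given points.* Let `x_l = φ(z_l)` be generic points of `V`. Since
taking `p`-th roots is an integral extension, the coordinates of the `z_l` satisfy only those
rational relations which hold identically on `W^d`; the same holds for the edge differences of the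
generic configuration `P`. Hence an automorphism of `ℂ` maps the edge differences of `P` to those of
the `z_l` (`exists_ringEquiv_edgeDiff_eq`), and carries a self-stress of `P` to a covector `ω`
annihilating every `T_{x_l} V`, with a Laplacian of the same rank.

*Dimension of the contact locus.* If `y = φ(z)` satisfies `T_y V ⊆ ⟨T_{x_1} V, …, T_{x_d} V⟩`, then
`z` lies in the set of all `z ∈ W` with `∑ ω_e z_e^(p-1) c_e = 0` for all `c ∈ W` and all such `ω`.
An irreducible component `Z` through `x_k` is the image under `φ` of an irreducible subset of the
closure of this set through a point `z_k` above `x_k`. Differentiating the equations at `z_k` bounds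
the tangent space there by `{c ∈ W : ∑ ω_e z_{k,e}^(p-2) c_e c'_e = 0 for all c' ∈ W}`, which is the
image of the kernel of the Laplacian. This kernel has dimension two and contains the constants, which
have no edge differences, so the tangent space has dimension at most one
(`finrank_le_one_of_rank_weightedLaplacian`). The dimension of a variety is at most that of its
tangent space at any point (`ringKrullDim_quotient_comap_le_finrank`), whence `dim Z ≤ 1`.
-/

noncomputable section

namespace LpRigidity

/-! ### Derivations and the dimension of a variety at a point -/

/-- In characteristic zero a field is formally smooth over any subring: it is separably generated
over the fraction field of the subring. -/
theorem formallySmooth_of_injective (R L : Type*) [CommRing R] [IsDomain R] [CharZero R] [Field L]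
    [Algebra R L] (h : Function.Injective (algebraMap R L)) : Algebra.FormallySmooth R L := by
  have : FaithfulSMul R L := (faithfulSMul_iff_algebraMap_injective R L).2 h
  let : Algebra (FractionRing R) L := FractionRing.liftAlgebra R L
  have : IsScalarTower R (FractionRing R) L := FractionRing.isScalarTower_liftAlgebra R L
  have : CharZero (FractionRing R) :=
    charZero_of_injective_algebraMap (IsFractionRing.injective R (FractionRing R))
  obtain ⟨s, hs⟩ := exists_isTranscendenceBasis (FractionRing R) L
  have := hs.isAlgebraic_field
  have : Algebra.FormallySmooth (FractionRing R) L :=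
    Algebra.FormallySmooth.of_algebraicIndependent_of_isSeparable hs.1
  have : Algebra.FormallySmooth R (FractionRing R) :=
    Algebra.FormallySmooth.of_isLocalization (nonZeroDivisors R)
  exact .comp R (FractionRing R) L

/-- In characteristic zero, derivations extend from a subring to a field: by formal smoothness
`L ⊗ Ω[R] → Ω[L]` is injective, and it splits as `L` is a field. -/
theorem exists_derivation_extension {k R L : Type*} [CommRing k] [CommRing R] [IsDomain R]
    [CharZero R] [Field L] [Algebra k R] [Algebra k L] [Algebra R L] [IsScalarTower k R L]
    (h : Function.Injective (algebraMap R L)) (D : Derivation k R L) :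
    ∃ D' : Derivation k L L, ∀ r, D' (algebraMap R L r) = D r := by
  have := formallySmooth_of_injective R L h
  have hinj : Function.Injective (KaehlerDifferential.mapBaseChange k R L) := by
    rw [injective_iff_map_eq_zero]
    intro x hx
    obtain ⟨y, rfl⟩ := (Algebra.H1Cotangent.exact_δ_mapBaseChange k R L x).1 hx
    rw [Subsingleton.elim y 0, map_zero]
  obtain ⟨g, hg⟩ := (KaehlerDifferential.mapBaseChange k R L).exists_leftInverse_of_injective
    (LinearMap.ker_eq_bot.2 hinj)
  let ℓ : TensorProduct R L (Ω[R⁄k]) →ₗ[L] L :=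
    D.liftKaehlerDifferential.liftBaseChange L
  refine ⟨(ℓ.comp g).compDer (KaehlerDifferential.D k L), fun r => ?_⟩
  have h1 : KaehlerDifferential.D k L (algebraMap R L r)
      = KaehlerDifferential.mapBaseChange k R L (1 ⊗ₜ[R] KaehlerDifferential.D k R r) := by
    simp
  have h2 := LinearMap.congr_fun hg (1 ⊗ₜ[R] KaehlerDifferential.D k R r)
  simp only [LinearMap.comp_apply, LinearMap.id_apply] at h2
  change ℓ (g (KaehlerDifferential.D k L (algebraMap R L r))) = D r
  rw [h1, h2]
  simp [ℓ]

theorem derivation_aeval {k σ A M : Type*} [CommRing k] [CommRing A] [Algebra k A] [AddCommGroup M]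
    [Module k M] [Module A M] [IsScalarTower k A M] [Fintype σ] (D : Derivation k A M) (x : σ → A)
    (f : MvPolynomial σ k) :
    D (MvPolynomial.aeval x f)
      = ∑ s, MvPolynomial.aeval x (MvPolynomial.pderiv s f) • D (x s) := by
  classical
  induction f using MvPolynomial.induction_on with
  | C a => simp
  | add f g hf hg => simp [hf, hg, add_smul, Finset.sum_add_distrib]
  | mul_X f i hf =>
    simp only [map_mul, MvPolynomial.aeval_X, Derivation.leibniz, hf, MvPolynomial.pderiv_X,
      smul_eq_mul, map_add, add_smul, Finset.sum_add_distrib, Finset.smul_sum, mul_smul]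
    simp only [Pi.single_comm _ _ i, Pi.single_apply]
    simp

theorem ringKrullDim_le_of_isIntegral {R S : Type*} [CommRing R] [CommRing S] (f : R →+* S)
    (hf : f.IsIntegral) : ringKrullDim S ≤ ringKrullDim R := by
  let := f.toAlgebra
  have : Algebra.IsIntegral R S := ⟨hf⟩
  refine Order.krullDim_le_of_strictMono (PrimeSpectrum.comap (algebraMap R S)) ?_
  intro P Q h
  exact Ideal.IsIntegral.comap_lt_comap (R := R) (I := P.asIdeal) (J := Q.asIdeal) h

/-- Let `x` be a point over a field `L` that specializes to `w`. If the gradients at `w` of the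
members of `Q`, together with the vectors `c j`, span the whole space, then the gradients at `x` and
the `c j` have no common kernel. -/
theorem eq_zero_of_gradient_eq_zero {σ α k L : Type*} [Fintype σ] [Fintype α] [Field k] [Field L]
    [Algebra k L] {Q : Ideal (MvPolynomial σ k)} {w : σ → k} {x : σ → L}
    (hx : ∀ f : MvPolynomial σ k, MvPolynomial.aeval x f = 0 → MvPolynomial.eval w f = 0)
    (c : α → σ → k)
    (hspan : ∀ s : σ → k, ∃ f ∈ Q, ∃ a : α → k, ∀ i,
      s i = MvPolynomial.eval w (MvPolynomial.pderiv i f) + ∑ j, a j * c j i)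
    {v : σ → L}
    (hv : ∀ f ∈ Q, ∑ i, MvPolynomial.aeval x (MvPolynomial.pderiv i f) * v i = 0)
    (hc : ∀ j, ∑ i, algebraMap k L (c j i) * v i = 0) : v = 0 := by
  classical
  -- The rows of `M` combine gradients and the `c j` so that `M` is the identity matrix at `w`;
  -- hence its determinant does not vanish at `x`.
  choose f hf a ha using fun t : σ => hspan (Pi.single t 1)
  let M : Matrix σ σ (MvPolynomial σ k) := Matrix.of fun t i =>
    MvPolynomial.pderiv i (f t) + MvPolynomial.C (∑ j, a t j * c j i)
  have h1 : MvPolynomial.eval w M.det = 1 := by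
    rw [RingHom.map_det]
    convert Matrix.det_one (n := σ) (R := k)
    ext t i
    simp [M, Matrix.one_apply, ← ha t i, Pi.single_apply, eq_comm]
  have h2 : (M.map (MvPolynomial.aeval (R := k) x)).det ≠ 0 := by
    have e : (M.map (MvPolynomial.aeval (R := k) x)).det = MvPolynomial.aeval x M.det :=
      (AlgHom.map_det (MvPolynomial.aeval (R := k) x) M).symm
    rw [e]
    intro h
    rw [hx _ h] at h1
    exact zero_ne_one h1
  refine Matrix.eq_zero_of_mulVec_eq_zero h2 (funext fun t => ?_)
  have h3 : ∑ i, (∑ j, algebraMap k L (a t j) * algebraMap k L (c j i)) * v i = 0 := by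
    simp only [Finset.sum_mul]
    rw [Finset.sum_comm]
    refine Finset.sum_eq_zero fun j _ => ?_
    simp only [mul_assoc, ← Finset.mul_sum, hc j, mul_zero]
  simp [Matrix.mulVec, dotProduct, M, add_mul, Finset.sum_add_distrib, hv _ (hf t), h3]

/-- If `T` is the annihilator of `G` under the dot product, `G` has a complement spanned by `dim T`
vectors. -/
theorem exists_complement_of_annihilator {σ k : Type*} [Fintype σ] [Field k]
    (G : Submodule k (σ → k)) (T : Submodule k (σ → k))
    (hT : ∀ v, v ∈ T ↔ ∀ g ∈ G, ∑ i, g i * v i = 0) :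
    ∃ c : Fin (Module.finrank k T) → σ → k, ∀ s : σ → k, ∃ g ∈ G, ∃ a : Fin (Module.finrank k T) → k, ∀ i,
      s i = g i + ∑ j, a j * c j i := by
  classical
  obtain ⟨C, hC⟩ := G.exists_isCompl
  have hdim : Module.finrank k T = Module.finrank k C := by
    let e := (Pi.basisFun k σ).toDualEquiv
    have h1 : T.map e.toLinearMap = G.dualAnnihilator := by
      ext ξ
      obtain ⟨v, rfl⟩ := e.surjective ξ
      have h2 : ∀ g, e v g = ∑ i, g i * v i := by
        intro g
        conv_lhs => rw [← (Pi.basisFun k σ).sum_repr g]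
        simp only [map_sum, map_smul]
        refine Finset.sum_congr rfl fun i _ => ?_
        rw [Module.Basis.toDualEquiv_apply, Module.Basis.toDual_apply_left]
        simp
      simp [Submodule.mem_dualAnnihilator, hT, h2]
    have h2 := LinearEquiv.finrank_map_eq e T
    have h3 := Subspace.finrank_add_finrank_dualAnnihilator_eq G
    have h4 := Submodule.finrank_add_eq_of_isCompl hC
    rw [← h1] at h3
    have h5 : Module.finrank k (T.map e.toLinearMap) = Module.finrank k T := h2
    omega
  let b := (Module.finBasisOfFinrankEq k C hdim.symm)
  refine ⟨fun j => b j, fun s => ?_⟩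
  obtain ⟨g, hg, d, hd, rfl⟩ := Submodule.mem_sup.1 (hC.sup_eq_top ▸ Submodule.mem_top : s ∈ G ⊔ C)
  refine ⟨g, hg, b.repr ⟨d, hd⟩, fun i => ?_⟩
  have h : (∑ j, b.repr ⟨d, hd⟩ j • (b j : σ → k)) = d := by
    simpa only [Submodule.coe_sum, Submodule.coe_smul] using
      congrArg Subtype.val (b.sum_repr ⟨d, hd⟩)
  simp [← congrFun h i]

/-- If the function field at the generic point `x` of an irreducible variety contains `s`
algebraically independent regular functions, the tangent space at any point has dimension at least
`s`: the partial derivatives in these functions extend to the function field and give independent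
vectors in the kernel of the Jacobian at `x`, whose corank can only grow under specialization. -/
theorem card_le_finrank_tangentSpace {τ L : Type*} [Fintype τ] [Field L] [Algebra ℂ L]
    (Q : Ideal (MvPolynomial τ ℂ)) [Q.IsPrime] {w : τ → ℂ} (hw : w ∈ MvPolynomial.zeroLocus ℂ Q)
    {x : τ → L} (hx : ∀ f : MvPolynomial τ ℂ, MvPolynomial.aeval x f = 0 ↔ f ∈ Q)
    {s : ℕ} (h : MvPolynomial (Fin s) ℂ →ₐ[ℂ] L) (hh : Function.Injective h)
    (hrange : h.range ≤ (MvPolynomial.aeval (R := ℂ) x).range) :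
    s ≤ Module.finrank ℂ (tangentSpace (MvPolynomial.zeroLocus ℂ Q) w) := by
  classical
  let T := tangentSpace (MvPolynomial.zeroLocus ℂ Q) w
  let grad : MvPolynomial τ ℂ →ₗ[ℂ] (τ → ℂ) :=
    LinearMap.pi fun t => (MvPolynomial.aeval (R := ℂ) w).toLinearMap ∘ₗ
      (MvPolynomial.pderiv t).toLinearMap
  have hgrad : ∀ f t, grad f t = MvPolynomial.eval w (MvPolynomial.pderiv t f) := by
    intro f t
    simp [grad, MvPolynomial.aeval_eq_eval]
  let G : Submodule ℂ (τ → ℂ) := (Q.restrictScalars ℂ).map grad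
  obtain ⟨c, hc⟩ := exists_complement_of_annihilator G T (by
      intro v
      change (∀ f ∈ MvPolynomial.vanishingIdeal ℂ (MvPolynomial.zeroLocus ℂ Q), _) ↔ _
      rw [MvPolynomial.IsPrime.vanishingIdeal_zeroLocus]
      simp [G, hgrad])
  let _ : Algebra (MvPolynomial (Fin s) ℂ) L := h.toAlgebra
  have : IsScalarTower ℂ (MvPolynomial (Fin s) ℂ) L := .of_algHom h
  choose D hD using fun i : Fin s => exists_derivation_extension (k := ℂ) (L := L) hh
    (MvPolynomial.mkDerivation ℂ (Pi.single i (1 : L)))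
  let F : (Fin s → L) →ₗ[L] (Fin (Module.finrank ℂ T) → L) :=
    ∑ i, (LinearMap.proj i : (Fin s → L) →ₗ[L] L).smulRight
      (fun j => ∑ t, algebraMap ℂ L (c j t) * D i (x t))
  have hF : Function.Injective F := by
    rw [injective_iff_map_eq_zero]
    intro a ha
    let E : Derivation ℂ L L := ∑ i, a i • D i
    have hE : ∀ y, E y = ∑ i, a i * D i y := by
      intro y
      have : (E : L → L) = ∑ i, ⇑(a i • D i) := map_sum Derivation.coeFnAddMonoidHom _ _
      simp [this]
    have hEx : (fun t => E (x t)) = 0 := by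
      refine eq_zero_of_gradient_eq_zero (Q := Q) (w := w) (x := x) ?_ c ?_ ?_ ?_
      · intro f hf
        exact hw f ((hx f).1 hf)
      · intro s
        obtain ⟨_, ⟨f, hf, rfl⟩, a, h⟩ := hc s
        exact ⟨f, hf, a, fun i => by rw [h i, hgrad]⟩
      · intro f hf
        have := derivation_aeval E x f
        rw [(hx f).2 hf, map_zero] at this
        exact this.symm
      · intro j
        have h1 := congrFun ha j
        simp only [F, LinearMap.sum_apply, Finset.sum_apply, LinearMap.smulRight_apply,
          LinearMap.proj_apply, Pi.smul_apply, smul_eq_mul, Pi.zero_apply, Finset.mul_sum] at h1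
        rw [Finset.sum_comm] at h1
        simp only [hE, Finset.mul_sum]
        rw [← h1]
        exact Finset.sum_congr rfl fun _ _ => Finset.sum_congr rfl fun _ _ => by ring
    have hE0 : ∀ f : MvPolynomial τ ℂ, E (MvPolynomial.aeval x f) = 0 := by
      intro f
      rw [derivation_aeval]
      exact Finset.sum_eq_zero fun t _ => by rw [congrFun hEx t]; simp
    ext i
    obtain ⟨f, hf⟩ := hrange ⟨MvPolynomial.X i, rfl⟩
    have h2 : E (algebraMap (MvPolynomial (Fin s) ℂ) L (MvPolynomial.X i)) = 0 :=
      (congrArg E hf.symm).trans (hE0 f)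
    rw [hE] at h2
    simpa [hD, Pi.single_apply] using h2
  simpa using LinearMap.finrank_le_finrank_of_injective hF

/-- The dimension of an irreducible variety, given by a prime ideal `Q`, is at most the dimension of
its tangent space at any of its points. The bound is stated for the closure of the image of the
variety under a polynomial map, whose coordinate ring embeds in that of the variety. -/
theorem ringKrullDim_quotient_comap_le_finrank {σ τ : Type*} [Finite σ] [Fintype τ]
    (φ : MvPolynomial σ ℂ →ₐ[ℂ] MvPolynomial τ ℂ) (Q : Ideal (MvPolynomial τ ℂ)) [Q.IsPrime]
    {w : τ → ℂ} (hw : w ∈ MvPolynomial.zeroLocus ℂ Q) :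
    ringKrullDim (MvPolynomial σ ℂ ⧸ Q.comap φ)
      ≤ Module.finrank ℂ (tangentSpace (MvPolynomial.zeroLocus ℂ Q) w) := by
  have : (Q.comap φ).IsPrime := inferInstance
  have : Nontrivial (MvPolynomial σ ℂ ⧸ Q.comap φ) :=
    Ideal.Quotient.nontrivial_iff.2 this.ne_top
  -- Noether normalization turns the Krull dimension into a number of independent coordinates.
  obtain ⟨s, g, hg, hgi⟩ := exists_integral_inj_algHom_of_fg ℂ (MvPolynomial σ ℂ ⧸ Q.comap φ)
  have hdim : ringKrullDim (MvPolynomial σ ℂ ⧸ Q.comap φ) ≤ s := by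
    refine (ringKrullDim_le_of_isIntegral g.toRingHom hgi).trans ?_
    simp [MvPolynomial.ringKrullDim_of_isNoetherianRing]
  refine hdim.trans ?_
  norm_cast
  let φ' : (MvPolynomial σ ℂ ⧸ Q.comap φ) →ₐ[ℂ] (MvPolynomial τ ℂ ⧸ Q) :=
    Ideal.quotientMapₐ Q φ le_rfl
  have hφ' : Function.Injective φ' := Ideal.quotientMap_injective
  let ι : (MvPolynomial τ ℂ ⧸ Q) →ₐ[ℂ] FractionRing (MvPolynomial τ ℂ ⧸ Q) :=
    IsScalarTower.toAlgHom ℂ _ _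
  have hι : Function.Injective ι := IsFractionRing.injective (MvPolynomial τ ℂ ⧸ Q) _
  have hx : MvPolynomial.aeval (fun t => ι (Ideal.Quotient.mkₐ ℂ Q (MvPolynomial.X t)))
      = ι.comp (Ideal.Quotient.mkₐ ℂ Q) := by
    ext t
    rw [MvPolynomial.aeval_X]
    rfl
  refine card_le_finrank_tangentSpace Q hw
    (x := fun t => ι (Ideal.Quotient.mkₐ ℂ Q (MvPolynomial.X t))) ?_ (ι.comp (φ'.comp g))
    (hι.comp (hφ'.comp hg)) ?_
  · intro f
    rw [hx, AlgHom.comp_apply, map_eq_zero_iff ι hι]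
    exact Ideal.Quotient.eq_zero_iff_mem
  · rintro _ ⟨y, rfl⟩
    obtain ⟨f, hf⟩ := Ideal.Quotient.mk_surjective (φ' (g y))
    refine ⟨f, ?_⟩
    rw [hx]
    exact congrArg ι hf

/-! ### Coordinatewise powers and the projected Cayley–Menger variety -/

theorem isIntegral_expand {σ k : Type*} [CommRing k] {p : ℕ} (hp : p ≠ 0) :
    (MvPolynomial.expand p : MvPolynomial σ k →ₐ[k] MvPolynomial σ k).toRingHom.IsIntegral := by
  intro f
  induction f using MvPolynomial.induction_on with
  | C a =>
    have h : MvPolynomial.C a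
        = (MvPolynomial.expand p : MvPolynomial σ k →ₐ[k] MvPolynomial σ k).toRingHom
          (MvPolynomial.C a) := by simp
    rw [h]
    exact RingHom.isIntegralElem_map _
  | add f g hf hg => exact hf.add _ hg
  | mul_X f i hf =>
    refine hf.mul _ (@IsIntegral.of_pow (MvPolynomial σ k) (MvPolynomial σ k) _ _
      (MvPolynomial.expand p : MvPolynomial σ k →ₐ[k] MvPolynomial σ k).toRingHom.toAlgebra _ _
      hp.bot_lt ?_)
    change RingHom.IsIntegralElem
      (MvPolynomial.expand p : MvPolynomial σ k →ₐ[k] MvPolynomial σ k).toRingHom _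
    have h : MvPolynomial.X i ^ p
        = (MvPolynomial.expand p : MvPolynomial σ k →ₐ[k] MvPolynomial σ k).toRingHom
          (MvPolynomial.X i) := by simp
    rw [h]
    exact RingHom.isIntegralElem_map _

/-- Lying over for `expand p`, the comorphism of the coordinatewise `p`-th power map. -/
theorem exists_prime_comap_expand_eq {σ k : Type*} [CommRing k] {p : ℕ} (hp : p ≠ 0)
    (J I : Ideal (MvPolynomial σ k)) [I.IsPrime]
    (h : ∀ f, MvPolynomial.expand p f ∈ J → f ∈ I) :
    ∃ Q ≥ J, Q.IsPrime ∧
      Q.comap (MvPolynomial.expand p : MvPolynomial σ k →ₐ[k] MvPolynomial σ k) = I := by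
  let φ := (MvPolynomial.expand p : MvPolynomial σ k →ₐ[k] MvPolynomial σ k).toRingHom
  let _ : Algebra (MvPolynomial σ k) (MvPolynomial σ k) := φ.toAlgebra
  have : @Algebra.IsIntegral (MvPolynomial σ k) (MvPolynomial σ k) _ _ φ.toAlgebra :=
    @Algebra.IsIntegral.mk _ _ _ _ φ.toAlgebra (isIntegral_expand hp)
  exact @Ideal.exists_ideal_over_prime_of_isIntegral _ _ _ _ φ.toAlgebra this I _ J h

/-- The power map sends the zero locus of `J` onto the zero locus of the contraction of `J`:
it is a finite map, hence closed. -/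
theorem exists_mem_zeroLocus_pow_eq {σ : Type*} [Finite σ] {p : ℕ} (hp : p ≠ 0)
    (J : Ideal (MvPolynomial σ ℂ)) (y : σ → ℂ)
    (h : ∀ f, MvPolynomial.expand p f ∈ J → MvPolynomial.aeval y f = 0) :
    ∃ z ∈ MvPolynomial.zeroLocus ℂ J, z ^ p = y := by
  obtain ⟨Q, hJQ, hQ, hQy⟩ := exists_prime_comap_expand_eq hp J
    (MvPolynomial.vanishingIdeal ℂ {y}) (fun f hf => by
      rw [MvPolynomial.mem_vanishingIdeal_singleton_iff]
      exact h f hf)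
  obtain ⟨M, hM, hQM⟩ := Q.exists_le_maximal hQ.ne_top
  obtain ⟨z, rfl⟩ := MvPolynomial.eq_vanishingIdeal_singleton_of_isMaximal ℂ hM
  refine ⟨z, fun f hf => ?_, ?_⟩
  · exact (MvPolynomial.mem_vanishingIdeal_singleton_iff z f).1 (hQM (hJQ hf))
  · funext s
    have h1 : (MvPolynomial.X s - MvPolynomial.C (y s) : MvPolynomial σ ℂ) ∈
        Q.comap (MvPolynomial.expand p : MvPolynomial σ ℂ →ₐ[ℂ] MvPolynomial σ ℂ) := by
      rw [hQy, MvPolynomial.mem_vanishingIdeal_singleton_iff]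
      simp [MvPolynomial.aeval_eq_eval]
    have h2 := (MvPolynomial.mem_vanishingIdeal_singleton_iff z _).1 (hQM h1)
    rw [MvPolynomial.aeval_expand] at h2
    simpa [MvPolynomial.aeval_eq_eval, sub_eq_zero] using h2

/-- The coboundary map of the graph `G`, sending a labelling of the vertices to its differences
along the edges, each taken as smaller end minus larger end. -/
def edgeDiff {n : ℕ} (G : SimpleGraph (Fin n)) (K : Type*) [CommRing K] :
    (Fin n → K) →ₗ[K] (G.edgeSet → K) where
  toFun q e := q (e : Sym2 (Fin n)).inf - q (e : Sym2 (Fin n)).sup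
  map_add' q r := by
    ext e
    simp only [Pi.add_apply]
    ring
  map_smul' c q := by
    ext e
    simp only [Pi.smul_apply, smul_eq_mul, RingHom.id_apply]
    ring

theorem edgeDiff_apply {n : ℕ} (G : SimpleGraph (Fin n)) {K : Type*} [CommRing K] (q : Fin n → K)
    (e : G.edgeSet) :
    edgeDiff G K q e = q (e : Sym2 (Fin n)).inf - q (e : Sym2 (Fin n)).sup := rfl

variable {n : ℕ} {G : SimpleGraph (Fin n)}

theorem map_edgeDiff {K L F : Type*} [CommRing K] [CommRing L] [FunLike F K L]
    [AddMonoidHomClass F K L] (f : F) (q : Fin n → K) (e : G.edgeSet) :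
    f (edgeDiff G K q e) = edgeDiff G L (fun i => f (q i)) e := by
  simp [edgeDiff_apply]

theorem vanishingIdeal_zariskiClosure {σ : Type*} (S : Set (σ → ℂ)) :
    MvPolynomial.vanishingIdeal ℂ (zariskiClosure S) = MvPolynomial.vanishingIdeal ℂ S :=
  le_antisymm (MvPolynomial.vanishingIdeal_anti_mono
    (MvPolynomial.zeroLocus_vanishingIdeal_le S))
    (MvPolynomial.le_vanishingIdeal_zeroLocus _)

theorem graphProj_measurementMap (p : ℕ) (q : Fin n → ℂ) :
    graphProj G (measurementMap n p q) = edgeDiff G ℂ q ^ p := rfl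

theorem mem_vanishingIdeal_projectedCayleyMenger {p : ℕ} {f : MvPolynomial G.edgeSet ℂ} :
    f ∈ MvPolynomial.vanishingIdeal ℂ (projectedCayleyMenger G p) ↔
      ∀ q : Fin n → ℂ, MvPolynomial.aeval (edgeDiff G ℂ q ^ p) f = 0 := by
  rw [projectedCayleyMenger, vanishingIdeal_zariskiClosure]
  constructor
  · intro h q
    rw [← graphProj_measurementMap]
    exact h _ ⟨_, MvPolynomial.zeroLocus_vanishingIdeal_le _ ⟨q, rfl⟩, rfl⟩
  · rintro h _ ⟨z, hz, rfl⟩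
    let ι : G.edgeSet → (⊤ : SimpleGraph (Fin n)).edgeSet :=
      fun e => ⟨e, SimpleGraph.edgeSet_mono le_top e.2⟩
    have h1 : ∀ z, MvPolynomial.aeval (graphProj G z) f
        = MvPolynomial.aeval z (MvPolynomial.rename ι f) := by
      intro z
      rw [MvPolynomial.aeval_rename]
      rfl
    rw [h1]
    refine hz _ ?_
    rintro _ ⟨q, rfl⟩
    rw [← h1]
    exact h q

/-- The space of edge differences is cut out by linear equations. -/
theorem exists_functional_of_forall_ne_edgeDiff [Fintype G.edgeSet] {z : G.edgeSet → ℂ}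
    (hz : ∀ q, z ≠ edgeDiff G ℂ q) :
    ∃ ξ : G.edgeSet → ℂ, (∀ q, ∑ e, ξ e * edgeDiff G ℂ q e = 0) ∧ ∑ e, ξ e * z e ≠ 0 := by
  classical
  have h : z ∉ LinearMap.range (edgeDiff G ℂ) := fun ⟨q, hq⟩ => hz q hq.symm
  obtain ⟨ξ, hξ, hle⟩ := Submodule.exists_le_ker_of_notMem h
  have h1 : ∀ x : G.edgeSet → ℂ, ∑ e, ξ (Pi.single e 1) * x e = ξ x := by
    intro x
    conv_rhs => rw [← (Pi.basisFun ℂ G.edgeSet).sum_repr x]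
    simp [mul_comm]
  exact ⟨fun e => ξ (Pi.single e 1), fun q => (h1 _).trans (hle ⟨q, rfl⟩), by rwa [h1]⟩

theorem mem_range_edgeDiff_of_mem_zeroLocus {z : G.edgeSet → ℂ}
    (hz : z ∈ MvPolynomial.zeroLocus ℂ
      (MvPolynomial.vanishingIdeal ℂ (Set.range (edgeDiff G ℂ)))) :
    ∃ q, z = edgeDiff G ℂ q := by
  have := Fintype.ofFinite G.edgeSet
  by_contra! hne
  obtain ⟨ξ, hξ, hξz⟩ := exists_functional_of_forall_ne_edgeDiff hne
  have h2 := hz (∑ e, MvPolynomial.C (ξ e) * MvPolynomial.X e) (by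
    rintro _ ⟨q, rfl⟩
    simpa [MvPolynomial.aeval_eq_eval] using hξ q)
  exact hξz (by simpa [MvPolynomial.aeval_eq_eval] using h2)

/-- The projected Cayley–Menger variety is the image of the space of edge differences under the
power map; no closure is needed. -/
theorem mem_projectedCayleyMenger {p : ℕ} (hp : p ≠ 0) {y : G.edgeSet → ℂ} :
    y ∈ projectedCayleyMenger G p ↔ ∃ q : Fin n → ℂ, y = edgeDiff G ℂ q ^ p := by
  constructor
  · intro hy
    have hy' : y ∈ zariskiClosure (projectedCayleyMenger G p) :=
      MvPolynomial.zeroLocus_vanishingIdeal_le _ hy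
    obtain ⟨z, hz, rfl⟩ := exists_mem_zeroLocus_pow_eq hp
      (MvPolynomial.vanishingIdeal ℂ (Set.range (edgeDiff G ℂ))) y (by
        intro f hf
        refine hy' f (mem_vanishingIdeal_projectedCayleyMenger.2 fun q => ?_)
        rw [← MvPolynomial.aeval_expand]
        exact hf _ ⟨q, rfl⟩)
    obtain ⟨q, rfl⟩ := mem_range_edgeDiff_of_mem_zeroLocus hz
    exact ⟨q, rfl⟩
  · rintro ⟨q, rfl⟩
    rw [← graphProj_measurementMap]
    exact MvPolynomial.zeroLocus_vanishingIdeal_le _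
      ⟨_, MvPolynomial.zeroLocus_vanishingIdeal_le _ ⟨q, rfl⟩, rfl⟩

/-! ### Tangent spaces -/

/-- The derivative of the power map carries edge differences to tangent vectors. -/
theorem pow_mul_edgeDiff_mem_tangentSpace [Fintype G.edgeSet] {p : ℕ} (hp : p ≠ 0)
    (q u : Fin n → ℂ) :
    edgeDiff G ℂ q ^ (p - 1) * edgeDiff G ℂ u
      ∈ tangentSpace (projectedCayleyMenger G p) (edgeDiff G ℂ q ^ p) := by
  intro f hf
  rw [mem_vanishingIdeal_projectedCayleyMenger] at hf
  -- Differentiate `f ((q + t u) ^ p) = 0` in `t` at `t = 0`.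
  let c : G.edgeSet → Polynomial ℂ := fun e =>
    Polynomial.C (edgeDiff G ℂ q e) + Polynomial.C (edgeDiff G ℂ u e) * Polynomial.X
  have h0 : MvPolynomial.aeval (c ^ p) f = 0 := by
    refine Polynomial.funext fun t => ?_
    have h1 := hf (q + t • u)
    rw [Polynomial.eval_zero, ← h1, ← Polynomial.coe_aeval_eq_eval]
    have h2 := MvPolynomial.comp_aeval_apply (c ^ p) (Polynomial.aeval t) f
    refine h2.trans ?_
    have h3 : (fun e => Polynomial.aeval t ((c ^ p) e)) = edgeDiff G ℂ (q + t • u) ^ p := by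
      funext e
      simp only [c, Pi.pow_apply, map_pow, map_add, map_mul, Polynomial.aeval_C,
        Polynomial.aeval_X, Algebra.algebraMap_self, RingHom.id_apply, map_smul, Pi.add_apply,
        Pi.smul_apply, smul_eq_mul]
      ring
    rw [h3]
  have h1 := derivation_aeval (Polynomial.derivative' (R := ℂ)) (c ^ p) f
  rw [h0, map_zero] at h1
  have h2 := congrArg (Polynomial.aeval (0 : ℂ)) h1
  simp only [map_zero, map_sum, smul_eq_mul, map_mul, MvPolynomial.comp_aeval_apply] at h2
  have h3 : (fun e => Polynomial.aeval (0 : ℂ) ((c ^ p) e)) = edgeDiff G ℂ q ^ p := by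
    funext e
    simp [c]
  rw [h3] at h2
  have hp' : (p : ℂ) ≠ 0 := by exact_mod_cast hp
  refine mul_left_cancel₀ hp' ?_
  rw [mul_zero, h2, Finset.mul_sum]
  refine Finset.sum_congr rfl fun e _ => ?_
  simp [c, MvPolynomial.aeval_eq_eval]
  ring

/-- A vector annihilated by the differentials at `x` of all rational polynomials vanishing at `x`
is the value at `x` of a derivation of `ℂ`: it defines one on `ℚ[x]`, which extends. -/
theorem exists_derivation_apply_eq {τ : Type*} [Fintype τ] {x v : τ → ℂ}
    (h : ∀ f : MvPolynomial τ ℚ, MvPolynomial.aeval x f = 0 →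
      ∑ t, MvPolynomial.aeval x (MvPolynomial.pderiv t f) * v t = 0) :
    ∃ D : Derivation ℚ ℂ ℂ, ∀ t, D (x t) = v t := by
  classical
  let ℓ : MvPolynomial τ ℚ → ℂ :=
    fun f => ∑ t, MvPolynomial.aeval x (MvPolynomial.pderiv t f) * v t
  have hadd : ∀ f g, ℓ (f + g) = ℓ f + ℓ g := fun f g => by
    simp [ℓ, add_mul, Finset.sum_add_distrib]
  have hsmul : ∀ (c : ℚ) f, ℓ (c • f) = c • ℓ f := fun c f => by
    simp [ℓ, Finset.smul_sum]
  have hmul : ∀ f g, ℓ (f * g) = MvPolynomial.aeval x f * ℓ g + MvPolynomial.aeval x g * ℓ f := by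
    intro f g
    simp only [ℓ, Derivation.leibniz, smul_eq_mul, map_add, map_mul, add_mul,
      Finset.sum_add_distrib, Finset.mul_sum, mul_assoc]
  have hwell : ∀ f g, MvPolynomial.aeval x f = MvPolynomial.aeval x g → ℓ f = ℓ g := by
    intro f g hfg
    have h1 : ℓ (f - g) = 0 := h _ (by rw [map_sub, hfg, sub_self])
    have h2 := hadd (f - g) g
    rwa [sub_add_cancel, h1, zero_add] at h2
  let R := (MvPolynomial.aeval (R := ℚ) x).range
  choose r hr using fun a : R => a.2
  replace hr : ∀ a : R, MvPolynomial.aeval x (r a) = (a : ℂ) := hr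
  let D₀ : Derivation ℚ R ℂ := Derivation.mk'
    { toFun := fun a => ℓ (r a)
      map_add' := fun a b => by
        rw [← hadd]
        exact hwell _ _ (by simp [hr])
      map_smul' := fun c a => by
        rw [RingHom.id_apply, ← hsmul]
        exact hwell _ _ (by simp [hr]) }
    (fun a b => by
      change ℓ (r (a * b)) = a • ℓ (r b) + b • ℓ (r a)
      have h1 : ℓ (r (a * b)) = ℓ (r a * r b) := hwell _ _ (by simp [hr])
      rw [h1, hmul, hr, hr]
      rfl)
  obtain ⟨D, hD⟩ := exists_derivation_extension (L := ℂ) Subtype.val_injective D₀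
  refine ⟨D, fun t => ?_⟩
  have h1 := hD ⟨x t, MvPolynomial.X t, by simp⟩
  refine h1.trans ?_
  change ℓ (r _) = _
  rw [hwell _ (MvPolynomial.X t) (by rw [hr]; simp)]
  simp [ℓ, MvPolynomial.pderiv_X, Pi.single_comm _ _ t, Pi.single_apply]

/-- At a generic point every tangent vector comes from edge differences: apply the derivation of
`ℂ` it defines to a configuration above the point. -/
theorem exists_eq_pow_mul_edgeDiff_of_mem_tangentSpace [Fintype G.edgeSet] {p : ℕ}
    {q : Fin n → ℂ}
    (hgen : ∀ f : MvPolynomial G.edgeSet ℚ, MvPolynomial.aeval (edgeDiff G ℂ q ^ p) f = 0 →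
      ∀ y ∈ projectedCayleyMenger G p, MvPolynomial.aeval y f = 0)
    {v : G.edgeSet → ℂ}
    (hv : v ∈ tangentSpace (projectedCayleyMenger G p) (edgeDiff G ℂ q ^ p)) :
    ∃ u : Fin n → ℂ, v = edgeDiff G ℂ q ^ (p - 1) * edgeDiff G ℂ u := by
  obtain ⟨D, hD⟩ := exists_derivation_apply_eq (x := edgeDiff G ℂ q ^ p) (v := v) (by
    intro f hf
    have h1 := hv (MvPolynomial.map (algebraMap ℚ ℂ) f) (by
      intro y hy
      rw [MvPolynomial.aeval_map_algebraMap]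
      exact hgen f hf y hy)
    simpa only [MvPolynomial.pderiv_map, MvPolynomial.eval_map, ← MvPolynomial.aeval_def] using h1)
  refine ⟨(p : ℂ) • fun i => D (q i), ?_⟩
  funext e
  rw [← hD, Pi.pow_apply, Derivation.leibniz_pow, map_edgeDiff]
  simp
  ring

/-! ### Transport of generic points by automorphisms of `ℂ` -/

/-- Two embeddings of a countable domain into `ℂ` differ by an automorphism of `ℂ`, as the two
transcendence degrees agree: both are the cardinality of the continuum. -/
theorem exists_ringEquiv_comp_eq {B : Type*} [CommRing B] [Countable B] (f g : B →+* ℂ)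
    (hf : Function.Injective f) (hg : Function.Injective g) :
    ∃ σ : ℂ ≃+* ℂ, ∀ b, σ (f b) = g b := by
  suffices H : ∀ (K L : Type) [Field K] [Field L] [IsAlgClosed K] [IsAlgClosed L] [Algebra B K]
      [Algebra B L], Function.Injective (algebraMap B K) → Function.Injective (algebraMap B L) →
      Cardinal.aleph0 < Cardinal.mk K → Cardinal.mk K = Cardinal.mk L →
      ∃ σ : K ≃+* L, ∀ b, σ (algebraMap B K b) = algebraMap B L b by
    have hc : Cardinal.aleph0 < Cardinal.mk ℂ := by
      rw [Cardinal.mk_complex]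
      exact Cardinal.aleph0_lt_continuum
    exact @H ℂ ℂ _ _ _ _ f.toAlgebra g.toAlgebra hf hg hc rfl
  intro K L _ _ _ _ _ _ hK hL hc hKL
  have := hK.isDomain (algebraMap B K)
  have : FaithfulSMul B K := (faithfulSMul_iff_algebraMap_injective B K).2 hK
  have : FaithfulSMul B L := (faithfulSMul_iff_algebraMap_injective B L).2 hL
  obtain ⟨s, hs⟩ := exists_isTranscendenceBasis B K
  obtain ⟨t, ht⟩ := exists_isTranscendenceBasis B L
  have hs' := IsAlgClosed.cardinal_eq_cardinal_transcendence_basis_of_aleph0_lt _ hs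
    Cardinal.mk_le_aleph0 hc
  have ht' := IsAlgClosed.cardinal_eq_cardinal_transcendence_basis_of_aleph0_lt _ ht
    Cardinal.mk_le_aleph0 (hKL ▸ hc)
  rw [Cardinal.lift_id, Cardinal.lift_id] at hs' ht'
  obtain ⟨e⟩ := Cardinal.eq.1 (hs'.symm.trans (hKL.trans ht'))
  have := IsAlgClosed.isAlgClosure_of_transcendence_basis _ hs
  have := IsAlgClosed.isAlgClosure_of_transcendence_basis _ ht
  let ε := (hs.1.aevalEquiv.symm.trans (MvPolynomial.renameEquiv B e)).trans ht.1.aevalEquiv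
  refine ⟨IsAlgClosure.equivOfEquiv K L ε.toRingEquiv, fun b => ?_⟩
  have h1 := IsAlgClosure.equivOfEquiv_algebraMap K L ε.toRingEquiv (algebraMap B _ b)
  rw [← IsScalarTower.algebraMap_apply] at h1
  rw [h1]
  change algebraMap _ L (ε (algebraMap B _ b)) = _
  rw [AlgEquiv.commutes, ← IsScalarTower.algebraMap_apply]

/-- A homomorphism out of a domain `B` which is injective on a subring over which `B` is integral
is injective. -/
theorem injective_of_isIntegral {A B C : Type*} [CommRing A] [CommRing B] [IsDomain B]
    [CommRing C] (i : A →+* B) (hi : i.IsIntegral) (f : B →+* C)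
    (h : ∀ a, f (i a) = 0 → i a = 0) : Function.Injective f := by
  rw [RingHom.injective_iff_ker_eq_bot]
  have hint : (algebraMap i.range B).IsIntegral :=
    RingHom.IsIntegral.tower_top i.rangeRestrict (algebraMap i.range B) hi
  have : Algebra.IsIntegral i.range B := ⟨hint⟩
  refine Ideal.eq_bot_of_comap_eq_bot (R := i.range) ?_
  rw [eq_bot_iff]
  rintro ⟨_, a, rfl⟩ ha
  exact Subtype.ext (h a ha)

variable {d : ℕ}

/-- The generic difference along an edge of the `l`-th coordinates of a configuration. -/
def genericDiff (G : SimpleGraph (Fin n)) (d : ℕ) (a : Fin d × G.edgeSet) :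
    MvPolynomial (Fin n × Fin d) ℚ :=
  edgeDiff G _ (fun i => MvPolynomial.X (i, a.1)) a.2

theorem aeval_genericDiff (q : Fin n → Fin d → ℂ) (a : Fin d × G.edgeSet) :
    MvPolynomial.aeval (fun b : Fin n × Fin d => q b.1 b.2) (genericDiff G d a)
      = edgeDiff G ℂ (fun i => q i a.1) a.2 := by
  rw [genericDiff, map_edgeDiff]
  simp

/-- Generic points of `V` are powers of the edge differences of a configuration which satisfies
no rational polynomial relation among its edge differences other than the identities. -/
theorem injective_aeval_of_isGenericTuple {p : ℕ} (hp : p ≠ 0) (q : Fin n → Fin d → ℂ)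
    (hgen : IsGenericTuple (projectedCayleyMenger G p)
      (fun l => edgeDiff G ℂ (fun i => q i l) ^ p)) :
    Function.Injective ((MvPolynomial.aeval (R := ℚ)
      (fun b : Fin n × Fin d => q b.1 b.2)).comp
        (MvPolynomial.aeval (R := ℚ) (genericDiff G d)).range.val) := by
  let θ := MvPolynomial.aeval (R := ℚ) (genericDiff G d)
  refine injective_of_isIntegral
    (θ.rangeRestrict.toRingHom.comp (MvPolynomial.expand p).toRingHom)
    ((isIntegral_expand hp).trans _ _
      (RingHom.isIntegral_of_surjective _ θ.rangeRestrict_surjective))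
    ((MvPolynomial.aeval (R := ℚ) (fun b : Fin n × Fin d => q b.1 b.2)).comp
      θ.range.val).toRingHom ?_
  have key : ∀ (r : Fin n × Fin d → ℂ) (a : MvPolynomial (Fin d × G.edgeSet) ℚ),
      MvPolynomial.aeval r (θ (MvPolynomial.expand p a)) = MvPolynomial.aeval
        (fun b : Fin d × G.edgeSet => (edgeDiff G ℂ (fun i => r (i, b.1)) ^ p) b.2) a := by
    intro r a
    rw [MvPolynomial.comp_aeval_apply, MvPolynomial.aeval_expand]
    congr 1
    congr 1
    funext b
    exact congrArg (· ^ p) (aeval_genericDiff (fun i l => r (i, l)) b)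
  intro a ha
  replace ha : MvPolynomial.aeval (fun b : Fin n × Fin d => q b.1 b.2)
      (θ (MvPolynomial.expand p a)) = 0 := ha
  rw [key] at ha
  have h1 := hgen.2 a ha
  refine Subtype.ext ?_
  change θ (MvPolynomial.expand p a) = 0
  refine MvPolynomial.funext fun r => (algebraMap ℚ ℂ).injective ?_
  have h2 := MvPolynomial.aeval_algebraMap_apply ℂ r (θ (MvPolynomial.expand p a))
  rw [MvPolynomial.aeval_eq_eval] at h2
  refine h2.symm.trans ?_
  rw [key]
  simpa using h1 _ fun l => (mem_projectedCayleyMenger hp).2 ⟨fun i => algebraMap ℚ ℂ (r (i, l)), rfl⟩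

/-- An automorphism of `ℂ` carries the edge differences of a generic configuration to those of any
configuration lying over generic points of `V`. -/
theorem exists_ringEquiv_edgeDiff_eq {p : ℕ} (hp : p ≠ 0) {P : Fin n → Fin d → ℝ}
    (hP : IsGenericConfig P) (q : Fin n → Fin d → ℂ)
    (hgen : IsGenericTuple (projectedCayleyMenger G p)
      (fun l => edgeDiff G ℂ (fun i => q i l) ^ p)) :
    ∃ σ : ℂ ≃+* ℂ, ∀ l e, σ (edgeDiff G ℝ (fun i => P i l) e : ℝ)
      = edgeDiff G ℂ (fun i => q i l) e := by
  -- `B` is the ring of rational polynomials in the edge differences. The larger ring of all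
  -- coordinates would not do, as the edge differences do not determine `q`.
  let B := (MvPolynomial.aeval (R := ℚ) (genericDiff G d)).range
  let f : B →ₐ[ℚ] ℂ :=
    (MvPolynomial.aeval (R := ℚ) (fun b : Fin n × Fin d => (P b.1 b.2 : ℂ))).comp B.val
  let g : B →ₐ[ℚ] ℂ :=
    (MvPolynomial.aeval (R := ℚ) (fun b : Fin n × Fin d => q b.1 b.2)).comp B.val
  have hf : Function.Injective f := by
    have h1 : AlgebraicIndependent ℚ (fun b : Fin n × Fin d => (P b.1 b.2 : ℂ)) :=
      hP.map' (f := (Complex.ofRealAm.restrictScalars ℚ)) Complex.ofReal_injective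
    exact Function.Injective.comp (g := MvPolynomial.aeval (R := ℚ)
      (fun b : Fin n × Fin d => (P b.1 b.2 : ℂ))) h1 Subtype.val_injective
  have : Countable (MvPolynomial (Fin n × Fin d) ℚ) := by
    rw [← Cardinal.mk_le_aleph0_iff]
    exact MvPolynomial.cardinalMk_le_max_lift.trans
      (by simpa using Cardinal.mk_le_aleph0 (α := Fin n × Fin d))
  obtain ⟨σ, hσ⟩ := exists_ringEquiv_comp_eq f.toRingHom g.toRingHom hf
    (injective_aeval_of_isGenericTuple hp q hgen)
  refine ⟨σ, fun l e => ?_⟩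
  have h1 := hσ ⟨genericDiff G d (l, e), MvPolynomial.X (l, e), MvPolynomial.aeval_X _ _⟩
  have h2 : f.toRingHom ⟨genericDiff G d (l, e), MvPolynomial.X (l, e), MvPolynomial.aeval_X _ _⟩
      = ((edgeDiff G ℝ (fun i => P i l) e : ℝ) : ℂ) :=
    (aeval_genericDiff (fun i l => (P i l : ℂ)) (l, e)).trans
      (map_edgeDiff Complex.ofRealHom (fun i => P i l) e).symm
  rw [h2] at h1
  exact h1.trans (aeval_genericDiff q (l, e))

/-! ### Self-stresses and Laplacians -/

open scoped Classical in
theorem sum_neighbors_eq_sum_edges {K : Type*} [AddCommMonoid K] [Fintype G.edgeSet]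
    (i : Fin n) (F : G.edgeSet → K) (hF : ∀ e : G.edgeSet, i ∉ (e : Sym2 (Fin n)) → F e = 0) :
    ∑ j, (if h : G.Adj i j then F ⟨s(i, j), h⟩ else 0) = ∑ e, F e := by
  have h1 : ∀ e : G.edgeSet, F e = ∑ j, if (e : Sym2 (Fin n)) = s(i, j) then F e else 0 := by
    intro e
    by_cases h : i ∈ (e : Sym2 (Fin n))
    · obtain ⟨k, hk⟩ := h
      simp only [hk, Sym2.congr_right]
      simp
    · simp [hF e h]
  rw [Finset.sum_congr rfl fun e _ => h1 e]
  rw [Finset.sum_comm]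
  refine Finset.sum_congr rfl fun j _ => ?_
  split_ifs with h
  · rw [Finset.sum_eq_single ⟨s(i, j), h⟩]
    · simp
    · intro e _ he
      rw [if_neg fun h' => he (Subtype.ext h')]
    · simp
  · refine (Finset.sum_eq_zero fun e _ => if_neg fun he => h ?_).symm
    rw [← SimpleGraph.mem_edgeSet, ← he]
    exact e.2

theorem edgeDiff_single_eq_zero {K : Type*} [CommRing K] {i : Fin n} {e : G.edgeSet}
    (h : i ∉ (e : Sym2 (Fin n))) : edgeDiff G K (Pi.single i 1) e = 0 := by
  obtain ⟨e, he⟩ := e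
  induction e using Sym2.ind with
  | _ a b =>
    rcases le_total a b with hab | hab <;> simp_all [edgeDiff_apply, eq_comm]

/-- Contracting a coboundary with the coboundary of a vertex indicator gives the signed difference
at that vertex. -/
theorem edgeDiff_single_mul_edgeDiff {K : Type*} [CommRing K] (v : Fin n → K) {i j : Fin n}
    (h : G.Adj i j) :
    edgeDiff G K (Pi.single i 1) ⟨s(i, j), h⟩ * edgeDiff G K v ⟨s(i, j), h⟩ = v i - v j := by
  rcases lt_or_gt_of_ne h.ne with hij | hij
  · simp [edgeDiff_apply, hij.le, h.ne']
  · simp [edgeDiff_apply, hij.le, h.ne']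

/-- A self-stress annihilates the vectors `z ^ (p - 1) * c` with `z` the edge differences of a
coordinate of the configuration and `c` any edge differences. -/
theorem IsSelfStress.sum_eq_zero [Fintype G.edgeSet] {p : ℕ} (hp : p ≠ 0) {P : Fin n → Fin d → ℝ}
    {w : G.edgeSet → ℝ} (hw : IsSelfStress p P w) (k : Fin d) (i : Fin n) :
    ∑ e, w e * (edgeDiff G ℝ (fun j => P j k) e ^ (p - 1)
      * edgeDiff G ℝ (Pi.single i 1) e) = 0 := by
  classical
  have h1 := hw i k
  rw [← sum_neighbors_eq_sum_edges i _ fun e he => by rw [edgeDiff_single_eq_zero he]; simp]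
  refine (mul_eq_zero.1 ?_).resolve_left (pow_ne_zero (p - 1) (by norm_num : (-1 : ℝ) ≠ 0))
  refine (Finset.mul_sum ..).trans (Eq.trans ?_ h1)
  refine Finset.sum_congr rfl fun j _ => ?_
  simp only [edgeVal, orientSign]
  split_ifs with hij hlt hlt
  · simp only [edgeDiff_apply, Sym2.inf_mk, Sym2.sup_mk, inf_eq_left.2 hlt.le,
      sup_eq_right.2 hlt.le, Pi.single_eq_same, Pi.single_eq_of_ne hij.ne']
    rw [← neg_sub (P i k), neg_pow (P i k - P j k)]
    ring
  · have hlt' : j < i := lt_of_le_of_ne (not_lt.1 hlt) hij.ne'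
    simp only [edgeDiff_apply, Sym2.inf_mk, Sym2.sup_mk, inf_eq_right.2 hlt'.le,
      sup_eq_left.2 hlt'.le, Pi.single_eq_same, Pi.single_eq_of_ne hij.ne']
    obtain ⟨m, rfl⟩ := Nat.exists_eq_succ_of_ne_zero hp
    simp only [Nat.succ_eq_add_one, Nat.add_sub_cancel, pow_succ]
    ring
  all_goals simp

/-- Transport of `IsSelfStress.sum_eq_zero` along a homomorphism `ρ : ℝ → ℂ`. -/
theorem sum_map_selfStress_eq_zero [Fintype G.edgeSet] {p : ℕ} (hp : p ≠ 0)
    {P : Fin n → Fin d → ℝ} {w : G.edgeSet → ℝ} (hw : IsSelfStress p P w) (ρ : ℝ →+* ℂ)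
    {k : Fin d} {z : G.edgeSet → ℂ} (hz : ∀ e, ρ (edgeDiff G ℝ (fun j => P j k) e) = z e)
    (u : Fin n → ℂ) : ∑ e, ρ (w e) * (z e ^ (p - 1) * edgeDiff G ℂ u e) = 0 := by
  classical
  have h1 : ∀ i, ∑ e, ρ (w e) * (z e ^ (p - 1) * edgeDiff G ℂ (Pi.single i 1) e) = 0 := by
    intro i
    have h2 := congrArg ρ (hw.sum_eq_zero hp k i)
    have h3 : (fun j => ρ ((Pi.single i 1 : Fin n → ℝ) j)) = Pi.single i 1 := by
      funext j
      simp [Pi.single_apply, apply_ite ρ]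
    simpa only [map_sum, map_mul, map_pow, hz, map_zero, map_edgeDiff ρ (Pi.single i 1), h3]
      using h2
  have h4 : u = ∑ i, u i • (Pi.single i 1 : Fin n → ℂ) := by
    simpa using (Pi.basisFun ℂ (Fin n)).sum_repr u |>.symm
  rw [h4]
  simp only [map_sum, map_smul, Finset.sum_apply, Pi.smul_apply, smul_eq_mul, Finset.mul_sum]
  rw [Finset.sum_comm]
  refine Finset.sum_eq_zero fun i _ => ?_
  rw [← mul_zero (u i), ← h1 i, Finset.mul_sum]
  exact Finset.sum_congr rfl fun e _ => by ring

/-- The Laplacian is the Gram matrix of the coboundary map for the form with weights `w`. -/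
theorem map_weightedLaplacian_mulVec [Fintype G.edgeSet] (w : G.edgeSet → ℝ) (ρ : ℝ →+* ℂ)
    (v : Fin n → ℂ) (i : Fin n) :
    ((weightedLaplacian w).map ρ).mulVec v i
      = ∑ e, ρ (w e) * (edgeDiff G ℂ (Pi.single i 1) e * edgeDiff G ℂ v e) := by
  classical
  rw [← sum_neighbors_eq_sum_edges i _ fun e he => by rw [edgeDiff_single_eq_zero he]; simp]
  have h0 : edgeVal w i i = 0 := by simp [edgeVal]
  have h1 : ∀ j, weightedLaplacian w i j
      = (if i = j then ∑ k, edgeVal w i k else 0) - edgeVal w i j := by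
    intro j
    by_cases h : i = j
    · subst h; simp [weightedLaplacian, h0]
    · simp [weightedLaplacian, h]
  have h2 : ((weightedLaplacian w).map ρ).mulVec v i
      = ∑ j, ρ (edgeVal w i j) * (v i - v j) := by
    simp only [Matrix.mulVec, dotProduct, Matrix.map_apply, h1, map_sub, sub_mul, mul_sub,
      Finset.sum_sub_distrib, apply_ite ρ, map_zero, ite_mul, zero_mul, map_sum]
    simp [Finset.sum_mul]
  rw [h2]
  refine Finset.sum_congr rfl fun j _ => ?_
  by_cases h : G.Adj i j
  · rw [dif_pos h, edgeDiff_single_mul_edgeDiff v h]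
    simp [edgeVal, h]
  · simp [edgeVal, h]

theorem rank_le_rank_map {m K L : Type*} [Fintype m] [Field K] [Field L] (M : Matrix m m K)
    (ρ : K →+* L) : M.rank ≤ (M.map ρ).rank := by
  let _ := ρ.toAlgebra
  obtain ⟨f, hf, -, hli⟩ := Submodule.exists_fun_fin_finrank_span_eq K (Set.range M.row)
  rw [M.rank_eq_finrank_span_row]
  have h1 : LinearIndependent L (fun i => algebraMap K L ∘ f i) :=
    linearIndependent_algebraMap_comp_iff.2 hli
  rw [Matrix.rank_eq_finrank_span_row]
  have h2 : ∀ i, (algebraMap K L ∘ f i) ∈ Submodule.span L (Set.range (M.map ρ).row) := by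
    intro i
    obtain ⟨j, hj⟩ := hf i
    refine Submodule.subset_span ⟨j, ?_⟩
    rw [← hj]
    rfl
  have h3 : LinearIndependent L
      (fun i => (⟨_, h2 i⟩ : Submodule.span L (Set.range (M.map ρ).row))) :=
    LinearIndependent.of_comp (Submodule.subtype _) h1
  simpa using h3.fintype_card_le_finrank

/-- If the Laplacian has corank two, its form on the space of edge differences has a radical of
dimension at most one: the kernel of the Laplacian contains the constants, which have no edge
differences. -/
theorem finrank_le_one_of_rank_weightedLaplacian [Fintype G.edgeSet] (hn : 2 ≤ n)
    {w : G.edgeSet → ℝ} (hw : (weightedLaplacian w).rank = n - 2) (ρ : ℝ →+* ℂ)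
    (T : Submodule ℂ (G.edgeSet → ℂ))
    (hT : ∀ t ∈ T, ∃ v, t = edgeDiff G ℂ v ∧
      ∀ u, ∑ e, ρ (w e) * (edgeDiff G ℂ u e * t e) = 0) :
    Module.finrank ℂ T ≤ 1 := by
  classical
  let M := (weightedLaplacian w).map ρ
  let N := LinearMap.ker M.mulVecLin
  have hN : Module.finrank ℂ N ≤ 2 := by
    have h1 := LinearMap.finrank_range_add_finrank_ker M.mulVecLin
    have h2 : n - 2 ≤ Module.finrank ℂ (LinearMap.range M.mulVecLin) :=
      hw ▸ rank_le_rank_map (weightedLaplacian w) ρ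
    rw [Module.finrank_fin_fun] at h1
    change Module.finrank ℂ (LinearMap.range M.mulVecLin) + Module.finrank ℂ N = n at h1
    omega
  let f := (edgeDiff G ℂ).domRestrict N
  have hle : T ≤ LinearMap.range f := by
    intro t ht
    obtain ⟨v, rfl, hv⟩ := hT t ht
    refine ⟨⟨v, ?_⟩, rfl⟩
    rw [LinearMap.mem_ker, Matrix.mulVecLin_apply]
    funext i
    rw [map_weightedLaplacian_mulVec]
    exact hv _
  have hone : edgeDiff G ℂ 1 = 0 := by
    funext e
    simp [edgeDiff_apply]
  have hker : 0 < Module.finrank ℂ (LinearMap.ker f) := by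
    have h1 : (1 : Fin n → ℂ) ∈ N := by
      rw [LinearMap.mem_ker, Matrix.mulVecLin_apply]
      funext i
      rw [map_weightedLaplacian_mulVec, hone]
      simp
    refine Nat.pos_of_ne_zero fun h0 => ?_
    have h : (⟨1, h1⟩ : N) = 0 := by
      have h3 : (⟨1, h1⟩ : N) ∈ LinearMap.ker f := hone
      rwa [Submodule.finrank_eq_zero.1 h0, Submodule.mem_bot] at h3
    have h2 := congrFun (congrArg Subtype.val h) ⟨0, by omega⟩
    simp at h2
  have h1 := LinearMap.finrank_range_add_finrank_ker f
  have h2 := Submodule.finrank_mono hle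
  omega

/-! ### Tangent contact loci -/

theorem isZariskiClosed_zeroLocus {σ : Type*} (I : Ideal (MvPolynomial σ ℂ)) :
    IsZariskiClosed (MvPolynomial.zeroLocus ℂ I) :=
  Set.Subset.antisymm
    (MvPolynomial.zeroLocus_anti_mono (MvPolynomial.le_vanishingIdeal_zeroLocus I))
    (MvPolynomial.zeroLocus_vanishingIdeal_le _)

theorem IsIrreducibleVariety.isPrime_vanishingIdeal {σ : Type*} {Z : Set (σ → ℂ)}
    (hZ : IsIrreducibleVariety Z) : (MvPolynomial.vanishingIdeal ℂ Z).IsPrime := by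
  obtain ⟨hcl, ⟨z, hz⟩, hirr⟩ := hZ
  refine ⟨fun h => ?_, ?_⟩
  · have h1 : (1 : MvPolynomial σ ℂ) ∈ MvPolynomial.vanishingIdeal ℂ Z := h ▸ Submodule.mem_top
    simpa using h1 z hz
  intro f g hfg
  let A : MvPolynomial σ ℂ → Set (σ → ℂ) := fun f =>
    MvPolynomial.zeroLocus ℂ (MvPolynomial.vanishingIdeal ℂ Z ⊔ Ideal.span {f})
  have hA : ∀ f x, x ∈ A f ↔ x ∈ Z ∧ MvPolynomial.aeval x f = 0 := by
    intro f x
    constructor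
    · intro hx
      refine ⟨?_, hx f (Ideal.mem_sup_right (Ideal.mem_span_singleton_self f))⟩
      rw [← hcl]
      exact fun h hh => hx h (Ideal.mem_sup_left hh)
    · rintro ⟨hx, hf⟩ h hh
      obtain ⟨a, ha, b, hb, rfl⟩ := Submodule.mem_sup.1 hh
      obtain ⟨c, rfl⟩ := Ideal.mem_span_singleton.1 hb
      rw [map_add, map_mul, ha x hx, hf, zero_mul, add_zero]
  have hmem : ∀ f, Z = A f → f ∈ MvPolynomial.vanishingIdeal ℂ Z :=
    fun f h x hx => ((hA f x).1 (h ▸ hx)).2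
  refine (hirr (A f) (A g) (isZariskiClosed_zeroLocus _) (isZariskiClosed_zeroLocus _) ?_).imp
    (hmem f) (hmem g)
  ext x
  rw [Set.mem_union, hA, hA]
  refine ⟨fun hx => ?_, fun h => h.elim And.left And.left⟩
  have := hfg x hx
  rw [map_mul, mul_eq_zero] at this
  exact this.imp (⟨hx, ·⟩) (⟨hx, ·⟩)

theorem IsGenericTuple.aeval_eq_zero {σ : Type*} {d : ℕ} {V : Set (σ → ℂ)} {x : Fin d → σ → ℂ}
    (hx : IsGenericTuple V x) (l : Fin d) {f : MvPolynomial σ ℚ}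
    (hf : MvPolynomial.aeval (x l) f = 0) {y : σ → ℂ} (hy : y ∈ V) :
    MvPolynomial.aeval y f = 0 := by
  have h := hx.2 (MvPolynomial.rename (fun s => (l, s)) f)
    (by rw [MvPolynomial.aeval_rename]; exact hf) (fun _ => y) (fun _ => hy)
  rw [MvPolynomial.aeval_rename] at h
  exact h

/-- The covectors annihilating all the tangent spaces of `V` at the points `x₁, …, x_d`. For the
Cayley–Menger variety and generic points these are the complex self-stresses. -/
def conormals {σ : Type*} [Fintype σ] (V : Set (σ → ℂ)) (x : Fin d → σ → ℂ) : Set (σ → ℂ) :=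
  {ω | ∀ l, ∀ t ∈ tangentSpace V (x l), ∑ s, ω s * t s = 0}

/-- The edge differences `z` of complex point configurations on the line for which every member
of `Ω` annihilates the tangent vectors `z ^ (p - 1) * c` at the point `z ^ p`. -/
def stressedDiffs [Fintype G.edgeSet] (p : ℕ) (Ω : Set (G.edgeSet → ℂ)) : Set (G.edgeSet → ℂ) :=
  {z | (∃ q, z = edgeDiff G ℂ q) ∧
    ∀ ω ∈ Ω, ∀ u, ∑ e, ω e * (z e ^ (p - 1) * edgeDiff G ℂ u e) = 0}

/-- The tangent contact locus is contained in the closure of the image of `stressedDiffs` under the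
power map. -/
theorem mem_vanishingIdeal_tangentContactLocus [Fintype G.edgeSet] {p : ℕ} (hp : p ≠ 0)
    (x : Fin d → G.edgeSet → ℂ) {f : MvPolynomial G.edgeSet ℂ}
    (hf : MvPolynomial.expand p f ∈ MvPolynomial.vanishingIdeal ℂ
      (stressedDiffs p (conormals (projectedCayleyMenger G p) x))) :
    f ∈ MvPolynomial.vanishingIdeal ℂ (tangentContactLocus (projectedCayleyMenger G p) x) := by
  rw [tangentContactLocus, vanishingIdeal_zariskiClosure]
  rintro y ⟨hy, hle⟩
  obtain ⟨q, rfl⟩ := (mem_projectedCayleyMenger hp).1 hy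
  rw [← MvPolynomial.aeval_expand]
  refine hf _ ⟨⟨q, rfl⟩, fun ω hω u => ?_⟩
  let K : Submodule ℂ (G.edgeSet → ℂ) := LinearMap.ker
    (∑ e, ω e • (LinearMap.proj e : (G.edgeSet → ℂ) →ₗ[ℂ] ℂ))
  have hK : ∀ t, t ∈ K ↔ ∑ e, ω e * t e = 0 := fun t => by simp [K]
  have h1 : ⨆ i, tangentSpace (projectedCayleyMenger G p) (x i) ≤ K :=
    iSup_le fun l t ht => (hK t).2 (hω l t ht)
  exact (hK _).1 (h1 (hle (pow_mul_edgeDiff_mem_tangentSpace hp q u)))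

/-- The tangent space of a subvariety of the closure of `stressedDiffs`, obtained by differentiating
the defining equations; the common factor `p - 1` is nonzero. -/
theorem tangentSpace_of_stressedDiffs [Fintype G.edgeSet] {p : ℕ} (hp : 2 ≤ p)
    {Ω : Set (G.edgeSet → ℂ)} {Q : Ideal (MvPolynomial G.edgeSet ℂ)}
    (hQ : MvPolynomial.vanishingIdeal ℂ (stressedDiffs p Ω) ≤ Q) {w t : G.edgeSet → ℂ}
    (ht : t ∈ tangentSpace (MvPolynomial.zeroLocus ℂ Q) w) :
    (∃ v, t = edgeDiff G ℂ v) ∧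
      ∀ ω ∈ Ω, ∀ u, ∑ e, ω e * w e ^ (p - 2) * (edgeDiff G ℂ u e * t e) = 0 := by
  classical
  replace ht : ∀ f ∈ MvPolynomial.vanishingIdeal ℂ (stressedDiffs p Ω),
      ∑ e, MvPolynomial.eval w (MvPolynomial.pderiv e f) * t e = 0 :=
    fun f hf => ht f (MvPolynomial.le_vanishingIdeal_zeroLocus Q (hQ hf))
  constructor
  · by_contra! hne
    obtain ⟨ξ, hξ, hξt⟩ := exists_functional_of_forall_ne_edgeDiff hne
    have h2 := ht (∑ e, MvPolynomial.C (ξ e) * MvPolynomial.X e) (by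
      rintro _ ⟨⟨q, rfl⟩, -⟩
      simpa [MvPolynomial.aeval_eq_eval] using hξ q)
    refine hξt ?_
    rw [← h2]
    simp [MvPolynomial.pderiv_X, Pi.single_apply]
  · intro ω hω u
    have h2 := ht (∑ e, MvPolynomial.C (ω e * edgeDiff G ℂ u e) * MvPolynomial.X e ^ (p - 1)) (by
      rintro z ⟨-, hz⟩
      rw [← hz ω hω u]
      simp only [map_sum, map_mul, map_pow, MvPolynomial.aeval_C, MvPolynomial.aeval_X,
        Algebra.algebraMap_self, RingHom.id_apply]
      exact Finset.sum_congr rfl fun e _ => by ring)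
    have hp' : ((p - 1 : ℕ) : ℂ) ≠ 0 := by
      rw [Nat.cast_ne_zero]; omega
    refine mul_left_cancel₀ hp' ?_
    rw [mul_zero, ← h2, Finset.mul_sum]
    refine Finset.sum_congr rfl fun e _ => ?_
    simp [MvPolynomial.pderiv_X, Derivation.leibniz_pow, Pi.single_apply, Nat.sub_sub]
    ring

end LpRigidity

end

theorem lemma3p4 (p n d : ℕ) (hp : 2 ≤ p) (hn : 2 ≤ n) (hd : 1 ≤ d)
    (G : SimpleGraph (Fin n)) [DecidableRel G.Adj] (P : Fin n → Fin d → ℝ)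
    (hP : LpRigidity.IsGenericConfig P)
    (hstress : ∀ k : Fin d, ∃ wk : G.edgeSet → ℝ,
      LpRigidity.IsCoordinatedSelfStress p P k wk ∧
        (LpRigidity.weightedLaplacian wk).rank = n - 2) :
    ¬ LpRigidity.IsTangentiallyWeaklyDefective d (LpRigidity.projectedCayleyMenger G p) := by
  open LpRigidity in
  have hp0 : p ≠ 0 := by omega
  rintro ⟨x, hx, k, Z, hZ, hxZ, hdim⟩
  have hI := hZ.1.1.isPrime_vanishingIdeal
  -- An irreducible variety, with ideal `Q`, which the power map sends onto `Z`, and a point `z` of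
  -- it above `x k`. It need not be the whole preimage of `Z`.
  obtain ⟨Q, hJQ, hQ, hQI⟩ := exists_prime_comap_expand_eq hp0
    (MvPolynomial.vanishingIdeal ℂ (stressedDiffs p (conormals (projectedCayleyMenger G p) x)))
    (MvPolynomial.vanishingIdeal ℂ Z) (fun f hf =>
      MvPolynomial.vanishingIdeal_anti_mono hZ.1.2
        (mem_vanishingIdeal_tangentContactLocus hp0 x hf))
  obtain ⟨z, hz, hzx⟩ := exists_mem_zeroLocus_pow_eq hp0 Q (x k) (fun f hf => by
    have h1 : f ∈ MvPolynomial.vanishingIdeal ℂ Z := hQI ▸ hf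
    exact h1 _ hxZ)
  obtain ⟨qk, hqk⟩ : ∃ q, z = edgeDiff G ℂ q := mem_range_edgeDiff_of_mem_zeroLocus
    (MvPolynomial.zeroLocus_anti_mono ((MvPolynomial.vanishingIdeal_anti_mono
      (by rintro _ ⟨⟨q, rfl⟩, -⟩; exact ⟨q, rfl⟩)).trans hJQ) hz)
  -- Configurations above all the points, the one above `x k` being that of `z`.
  choose q' hq' using fun l => (mem_projectedCayleyMenger hp0).1 (hx.1 l)
  obtain ⟨q, hqk', hq⟩ : ∃ q : Fin n → Fin d → ℂ, (fun i => q i k) = qk ∧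
      ∀ l, x l = edgeDiff G ℂ (fun i => q i l) ^ p := by
    refine ⟨fun i l => if l = k then qk i else q' l i, by simp, fun l => ?_⟩
    by_cases h : l = k
    · subst h; simp [← hzx, hqk]
    · simpa [h] using hq' l
  obtain rfl : x = fun l => edgeDiff G ℂ (fun i => q i l) ^ p := funext hq
  obtain ⟨σ, hσ⟩ := exists_ringEquiv_edgeDiff_eq hp0 hP q hx
  obtain ⟨wk, ⟨w, hw, hwk⟩, hrank⟩ := hstress k
  let ρ : ℝ →+* ℂ := σ.toRingHom.comp Complex.ofRealHom
  have hρ : ∀ l e, ρ (edgeDiff G ℝ (fun i => P i l) e) = edgeDiff G ℂ (fun i => q i l) e := hσ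
  have hconormal : (fun e => ρ (w e)) ∈ conormals (projectedCayleyMenger G p)
      (fun l => edgeDiff G ℂ (fun i => q i l) ^ p) := by
    intro l t ht
    obtain ⟨u, rfl⟩ := exists_eq_pow_mul_edgeDiff_of_mem_tangentSpace
      (fun f hf y hy => hx.aeval_eq_zero l hf hy) ht
    exact sum_map_selfStress_eq_zero hp0 hw ρ (hρ l) u
  have hfin : Module.finrank ℂ (tangentSpace (MvPolynomial.zeroLocus ℂ Q) z) ≤ 1 := by
    refine finrank_le_one_of_rank_weightedLaplacian hn hrank ρ _ fun t ht => ?_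
    obtain ⟨⟨v, hv⟩, h2⟩ := tangentSpace_of_stressedDiffs hp hJQ ht
    refine ⟨v, hv, fun u => ?_⟩
    have h3 := h2 _ hconormal u
    rw [← mul_zero ((-1 : ℂ) ^ (p - 2)), ← h3, Finset.mul_sum]
    refine Finset.sum_congr rfl fun e _ => ?_
    -- Coordinated stresses use larger end minus smaller end, edge differences the opposite.
    have h4 : ρ (wk e) = ρ (w e) * ((-1) ^ (p - 2) * z e ^ (p - 2)) := by
      rw [hwk, hqk, ← hqk', ← hρ k, edgeDiff_apply, ← mul_pow, ← map_one ρ, ← map_neg,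
        ← map_mul, neg_one_mul, neg_sub, map_mul, map_pow]
    rw [h4]
    ring
  have hle := ringKrullDim_quotient_comap_le_finrank
    (MvPolynomial.expand p : MvPolynomial G.edgeSet ℂ →ₐ[ℂ] MvPolynomial G.edgeSet ℂ) Q hz
  rw [hQI] at hle
  have h5 : (2 : WithBot ℕ∞) ≤ ((Module.finrank ℂ
      (tangentSpace (MvPolynomial.zeroLocus ℂ Q) z) : ℕ) : WithBot ℕ∞) := hdim.trans hle
  have h6 : 2 ≤ Module.finrank ℂ (tangentSpace (MvPolynomial.zeroLocus ℂ Q) z) := by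
    exact_mod_cast h5
  omega
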